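/- Let $q$ be an indeterminate. For an integer $j$ put $[j]=(1-q^j)/(1-q)$, and put $(a;b)_k=\prod_{i=0}^{k-1}(1-ab^i)$ for $k\ge 0$. Let $\Phi_n(q)$ denote the $n$-th cyclotomic polynomial. For rational functions $A,B\in\mathbb{Q}(q)$ and a polynomial $P\in\mathbb{Q}[q]$, write $A\equiv B\pmod{P}$ if $P$ divides, in $\mathbb{Q}[q]$, the numerator of $A-B$ written in lowest terms. **Theorem 1.1.** Let $n$ and $d$ be positive integers with $\gcd(n,d)=1$, let $r$ be an integer with $\gcd(r,d)=1$, and let $m$ be the least nonnegative residue of $-r/d$ modulo $n$, i.e. the integer with $0\le m<n$ and $dm\equiv -r\pmod n$. Then, both for $M=m$ and for $M=n-1$, $$\sum_{k=0}^{M}(-1)^k q^{d\binom{k+1}{2}-kr}\,[2dk+r]\,\frac{(q^r;q^d)_k^3}{(q^d;q^d)_k^3}\equiv(-1)^m q^{d\binom{m}{2}+mr}\left([md+r]+[md+r]^3\sum_{k=1}^{m}\frac{(-1)^k q^{d\binom{k+1}{2}}(1+q^{dk})}{[kd]^2}\right)\pmod{[n]\,\Phi_n(q)^3}.$$ -/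

import Mathlib

open Polynomial

noncomputable section

/-- The indeterminate `q`, as an element of the field `ℚ(q)` of rational functions. -/
abbrev qvar : RatFunc ℚ := RatFunc.X

/-- The `q`-integer `[j] = (1 - q^j) / (1 - q)`, for an arbitrary integer `j`. -/
def qInt (j : ℤ) : RatFunc ℚ := (1 - qvar ^ j) / (1 - qvar)

/-- The `q`-shifted factorial `(a; b)_k = (1 - a) (1 - a b) ⋯ (1 - a b^(k-1))`. -/
def qPoch (a b : RatFunc ℚ) (k : ℕ) : RatFunc ℚ := ∏ i ∈ Finset.range k, (1 - a * b ^ i)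

/-- The `q`-integer `[n]` of a natural number `n` as a polynomial, `1 + q + ⋯ + q^(n-1)`. -/
def qNatPoly (n : ℕ) : ℚ[X] := ∑ i ∈ Finset.range n, X ^ i

/-- The polynomial `1 + q + ⋯ + q^(n-1)` is the rational function `[n] = (1 - q^n) / (1 - q)`. -/
theorem algebraMap_qNatPoly (n : ℕ) :
    algebraMap ℚ[X] (RatFunc ℚ) (qNatPoly n) = qInt n := by
  have h : (1 : RatFunc ℚ) - qvar ≠ 0 := by
    rw [sub_ne_zero, qvar, ← RatFunc.algebraMap_X, ← map_one (algebraMap ℚ[X] (RatFunc ℚ))]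
    intro h
    have h2 := congrArg (Polynomial.eval 0) (RatFunc.algebraMap_injective ℚ h)
    simp at h2
  rw [qInt, eq_div_iff h, qNatPoly, map_sum]
  simp only [map_pow, RatFunc.algebraMap_X, zpow_natCast]
  exact geom_sum_mul_neg qvar n

/-- Congruence of rational functions modulo a polynomial: `A ≡ B (mod P)` means that `P` divides
the numerator of `A - B` written in lowest terms. -/
def RatFuncCong (P : ℚ[X]) (A B : RatFunc ℚ) : Prop := P ∣ (A - B).num

end

/-! Put `Q = q^d`, `A = q^r` and `x = q^(r+dm)`, so that `A = x Q^(-m)`. Up to the factor `1/(1-q)`,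
a unit at `Φ_e` for every `e > 1`, the left side is `S_M(A)`, the sum of `wellPoisedTerm A Q k` over
`k ≤ M`, and the right side is `expansionValue Q x m`. For `n > 1`, `[n]` is the product of the
coprime `Φ_e` with `e ∣ n`, `e > 1`, so it suffices to treat `Φ_n^4` and each `Φ_e` with `1 < e < n`
separately.

Modulo `Φ_n^4`: since `n ∣ r + dm`, `Φ_n` divides `1 - x`. The telescoping identity
`sum_wellPoisedTerm_add` links `S_m(B)` to `S_m(BQ)`. Taken at `B = x Q^(-m-1)` with upper limit `m
+ 1`, it drives an induction on `m` in which the last term and the boundary term both contain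
`(1-x)^3`, so modulo `(1-x)^4` only the values of their cofactors at `x = 1` matter
(`sum_wellPoisedTerm_expansion`). This settles `M = m`. For `M = n - 1` the terms with `m < k < n`
also contain `(1-x)^3`, and their cofactors cancel modulo `Φ_n` under `k ↦ m + n - k`
(`exists_sum_tail`).

Modulo `Φ_e`: the same kind of reflection, applied inside blocks of length `e`, annihilates the left
side (`sum_wellPoisedRec_blocks`); the right side keeps a factor `1 - x`
(`map_expansionValue_lt_one`). -/

noncomputable section

/-! ### A telescoping identity relating the parameters `B` and `BQ`. -/

section Telescoping

variable {K : Type*} [Field K]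

/-- The `k`-th term of the well-poised series with base `Q` and parameters `A, A, A`. -/
def wellPoisedTerm (A Q : K) (k : ℕ) : K :=
  (-1) ^ k * Q ^ (k + 1).choose 2 * (A ^ k)⁻¹ * (1 - A * Q ^ (2 * k)) *
    ((∏ i ∈ Finset.range k, (1 - A * Q ^ i)) / ∏ i ∈ Finset.range k, (1 - Q * Q ^ i)) ^ 3

theorem prod_one_sub_shift (B Q : K) (k : ℕ) :
    ∏ i ∈ Finset.range (k + 1), (1 - B * Q ^ i) =
      (1 - B) * ∏ i ∈ Finset.range k, (1 - B * Q * Q ^ i) := by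
  rw [Finset.prod_range_succ', mul_comm]
  simp [pow_succ', mul_assoc]

theorem prod_one_sub_pow_ne_zero {Q : K} {k : ℕ} (h : ∀ j, 0 < j → j ≤ k → 1 - Q ^ j ≠ 0) :
    ∏ i ∈ Finset.range k, (1 - Q * Q ^ i) ≠ 0 := by
  refine Finset.prod_ne_zero_iff.2 fun i hi => ?_
  rw [← pow_succ']
  exact h _ (Nat.succ_pos i) (Finset.mem_range.1 hi)

theorem choose_two_step (k : ℕ) : (k + 1 + 1).choose 2 = (k + 1).choose 2 + (k + 1) := by
  rw [Nat.choose_succ_succ' (k + 1) 1, Nat.choose_one_right, add_comm]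

/-- Telescoping form of the quasi-periodicity of the theta function `(A; Q)_∞ (Q / A; Q)_∞`. -/
theorem sum_wellPoisedTerm_add {B Q : K} (hQ : Q ≠ 0) (hB : B ≠ 0) (m : ℕ)
    (h : ∀ j, 0 < j → j ≤ m → 1 - Q ^ j ≠ 0) :
    ∑ k ∈ Finset.range (m + 1), wellPoisedTerm B Q k +
        B * ∑ k ∈ Finset.range (m + 1), wellPoisedTerm (B * Q) Q k =
      (-1) ^ m * Q ^ (m + 1).choose 2 * (B ^ m)⁻¹ * (1 - B ^ 2 * Q ^ (m + 1)) *
        ((∏ i ∈ Finset.range m, (1 - B * Q * Q ^ i)) /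
          ∏ i ∈ Finset.range m, (1 - Q * Q ^ i)) ^ 3 := by
  induction m with
  | zero => simp [wellPoisedTerm]; ring
  | succ m ih =>
    have ih := ih fun j h0 h1 => h j h0 (h1.trans m.le_succ)
    have hD := prod_one_sub_pow_ne_zero fun j h0 h1 => h j h0 (h1.trans m.le_succ)
    have hm : 1 - Q * Q ^ m ≠ 0 := by
      rw [← pow_succ']; exact h _ m.succ_pos le_rfl
    rw [Finset.sum_range_succ, Finset.sum_range_succ _ (m + 1), mul_add, add_add_add_comm, ih,
      wellPoisedTerm, wellPoisedTerm, prod_one_sub_shift, Finset.prod_range_succ _ m,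
      Finset.prod_range_succ _ m, choose_two_step]
    have hc : Q ^ ((m + 1).choose 2 + (m + 1)) = Q ^ (m + 1).choose 2 * (Q * Q ^ m) := by ring
    generalize (∏ i ∈ Finset.range m, (1 - B * Q * Q ^ i)) = p
    generalize (∏ i ∈ Finset.range m, (1 - Q * Q ^ i)) = D at *
    have h2 : Q ^ (2 * (m + 1)) = Q ^ 2 * (Q ^ m) ^ 2 := by ring
    have h3 : Q ^ (m + 1 + 1) = Q ^ 2 * Q ^ m := by ring
    have h4 : Q ^ (m + 1) = Q * Q ^ m := by ring
    rw [h2, hc, h3, h4]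
    simp only [mul_pow, pow_succ _ m]
    have hy : Q ^ m ≠ 0 := pow_ne_zero _ hQ
    have hb : B ^ m ≠ 0 := pow_ne_zero _ hB
    have hm' : 1 - Q ^ m * Q ≠ 0 := by rwa [mul_comm]
    generalize Q ^ m = y at *
    generalize Q ^ (m + 1).choose 2 = c
    generalize B ^ m = b at *
    field_simp
    ring

end Telescoping

/-! ### Expansion of the truncated series to fourth order at `x = 1`. -/

section Expansion

variable {K : Type*} [Field K]

/-- Congruence modulo `t` between elements of the subring `V`. -/
structure CongMod (V : Subring K) (t a b : K) : Prop where
  left : a ∈ V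
  right : b ∈ V
  dvd : ∃ h ∈ V, a = b + t * h

namespace CongMod

variable {V : Subring K} {t a b c e : K}

theorem refl (ha : a ∈ V) : CongMod V t a a := ⟨ha, ha, 0, V.zero_mem, by simp⟩

theorem mul (h₁ : CongMod V t a b) (h₂ : CongMod V t c e) : CongMod V t (a * c) (b * e) := by
  obtain ⟨ha, hb, u, hu, rfl⟩ := h₁
  obtain ⟨hc, he, w, hw, rfl⟩ := h₂
  refine ⟨V.mul_mem ha hc, V.mul_mem hb he, b * w + u * (e + t * w),
    V.add_mem (V.mul_mem hb hw) (V.mul_mem hu hc), by ring⟩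

theorem sub (h₁ : CongMod V t a b) (h₂ : CongMod V t c e) : CongMod V t (a - c) (b - e) := by
  obtain ⟨ha, hb, u, hu, rfl⟩ := h₁
  obtain ⟨hc, he, w, hw, rfl⟩ := h₂
  exact ⟨V.sub_mem ha hc, V.sub_mem hb he, u - w, V.sub_mem hu hw, by ring⟩

theorem pow (h : CongMod V t a b) (k : ℕ) : CongMod V t (a ^ k) (b ^ k) := by
  induction k with
  | zero => simpa using refl V.one_mem
  | succ k ih => rw [pow_succ, pow_succ]; exact ih.mul h

end CongMod

/-- At `x = 1` each factor is `1 - Q^(i-m) = -Q^(i-m) (1 - Q^(m-i))`, so the quotient collapses to a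
sign and a power of `Q`. In the induction, `AQ` for `m + 1` is `A` for `m`: removing the first
factor above and the last one below leaves the previous case. -/
theorem congMod_prod_div {V : Subring K} {Q x : K} (hQ0 : Q ≠ 0) (hQi : Q⁻¹ ∈ V)
    (hx : x ∈ V) (m : ℕ)
    (h : ∀ j, 0 < j → j ≤ m → 1 - Q ^ j ≠ 0) (hV : ∀ j, 0 < j → j ≤ m → (1 - Q ^ j)⁻¹ ∈ V) :
    CongMod V (1 - x)
      ((∏ i ∈ Finset.range m, (1 - x * (Q ^ m)⁻¹ * Q ^ i)) /
        ∏ i ∈ Finset.range m, (1 - Q * Q ^ i))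
      ((-1) ^ m * (Q ^ (m + 1).choose 2)⁻¹) := by
  induction m with
  | zero => simpa using CongMod.refl V.one_mem
  | succ m ih =>
    have ih := ih (fun j h0 h1 => h j h0 (h1.trans m.le_succ))
      (fun j h0 h1 => hV j h0 (h1.trans m.le_succ))
    have hm := h (m + 1) m.succ_pos le_rfl
    have hA : x * (Q ^ (m + 1))⁻¹ * Q = x * (Q ^ m)⁻¹ := by rw [pow_succ]; field_simp
    have hq : (Q ^ (m + 1))⁻¹ ∈ V := by rw [← inv_pow]; exact V.pow_mem hQi _
    have hx1 : CongMod V (1 - x) x 1 := ⟨hx, V.one_mem, -1, V.neg_mem V.one_mem, by ring⟩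
    have key := ((((CongMod.refl V.one_mem).sub (hx1.mul (CongMod.refl hq))).mul
      (CongMod.refl (hV (m + 1) m.succ_pos le_rfl)))).mul ih
    rw [prod_one_sub_shift, hA, Finset.prod_range_succ]
    convert key using 1
    · rw [← pow_succ', div_eq_mul_inv, div_eq_mul_inv, mul_inv]; ring
    · rw [choose_two_step, pow_add]
      field_simp
      ring

/-- The expansion, up to fourth order at `x = 1`, of the truncated well-poised series with
parameter `A = x * Q ^ (-m)`. -/
theorem sum_wellPoisedTerm_expansion {V : Subring K} {Q x : K} (hQ0 : Q ≠ 0) (hQ : Q ∈ V)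
    (hQi : Q⁻¹ ∈ V) (hx0 : x ≠ 0) (hx : x ∈ V) (hxi : x⁻¹ ∈ V) (m : ℕ)
    (h : ∀ j, 0 < j → j ≤ m → 1 - Q ^ j ≠ 0) (hV : ∀ j, 0 < j → j ≤ m → (1 - Q ^ j)⁻¹ ∈ V) :
    ∃ u ∈ V, ∑ k ∈ Finset.range (m + 1), wellPoisedTerm (x * (Q ^ m)⁻¹) Q k =
      (-1) ^ m * (Q ^ (m + 1).choose 2)⁻¹ * x ^ m * ((1 - x) + (1 - x) ^ 3 *
        ∑ k ∈ Finset.Icc 1 m,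
          (-1) ^ k * Q ^ (k + 1).choose 2 * (1 + Q ^ k) / (1 - Q ^ k) ^ 2) +
      (1 - x) ^ 4 * u := by
  induction m with
  | zero => exact ⟨0, V.zero_mem, by simp [wellPoisedTerm]⟩
  | succ m ih =>
    have h' := fun j h0 h1 => h j h0 (Nat.le_trans h1 m.le_succ)
    have hV' := fun j h0 h1 => hV j h0 (Nat.le_trans h1 m.le_succ)
    obtain ⟨u, hu, ih⟩ := ih h' hV'
    have hm := h (m + 1) m.succ_pos le_rfl
    have hmV := hV (m + 1) m.succ_pos le_rfl
    have hB0 : x * (Q ^ (m + 1))⁻¹ ≠ 0 := mul_ne_zero hx0 (inv_ne_zero (pow_ne_zero _ hQ0))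
    have hA : x * (Q ^ (m + 1))⁻¹ * Q = x * (Q ^ m)⁻¹ := by rw [pow_succ]; field_simp
    have hBV : x * (Q ^ (m + 1))⁻¹ ∈ V := by
      rw [← inv_pow]; exact V.mul_mem hx (V.pow_mem hQi _)
    have hAx : x * (Q ^ m)⁻¹ * Q ^ m = x := by field_simp
    -- With `B = x Q^(-m-1)`, the shifted parameter `BQ` is the one in the induction hypothesis.
    have tel := sum_wellPoisedTerm_add hQ0 hB0 (m + 1) h
    -- The product of length `m + 1` ends with `1 - A Q^m = 1 - x`, and it is cubed; the same holds
    -- for the boundary term in `hG`.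
    have hT : wellPoisedTerm (x * (Q ^ m)⁻¹) Q (m + 1) = (1 - x) ^ 3 *
        ((-1) ^ (m + 1) * Q ^ (m + 1 + 1).choose 2 * ((x * (Q ^ m)⁻¹) ^ (m + 1))⁻¹ *
        (1 - x * (Q ^ m)⁻¹ * Q ^ (2 * (m + 1))) * (1 - Q ^ (m + 1))⁻¹ ^ 3 *
        ((∏ i ∈ Finset.range m, (1 - x * (Q ^ m)⁻¹ * Q ^ i)) /
          ∏ i ∈ Finset.range m, (1 - Q * Q ^ i)) ^ 3) := by
      rw [wellPoisedTerm, Finset.prod_range_succ, hAx, Finset.prod_range_succ _ m, ← pow_succ',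
        div_eq_mul_inv, div_eq_mul_inv, mul_inv]
      ring
    have hG : ((∏ i ∈ Finset.range (m + 1), (1 - x * (Q ^ m)⁻¹ * Q ^ i)) /
          ∏ i ∈ Finset.range (m + 1), (1 - Q * Q ^ i)) ^ 3 = (1 - x) ^ 3 *
          ((1 - Q ^ (m + 1))⁻¹ ^ 3 * ((∏ i ∈ Finset.range m, (1 - x * (Q ^ m)⁻¹ * Q ^ i)) /
          ∏ i ∈ Finset.range m, (1 - Q * Q ^ i)) ^ 3) := by
      rw [Finset.prod_range_succ, hAx, Finset.prod_range_succ _ m, ← pow_succ',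
        div_eq_mul_inv, div_eq_mul_inv, mul_inv]
      ring
    rw [hA, Finset.sum_range_succ (wellPoisedTerm (x * (Q ^ m)⁻¹) Q), ih, hT, hG] at tel
    have hρ := congMod_prod_div hQ0 hQi hx m h' hV'
    generalize (∏ i ∈ Finset.range m, (1 - x * (Q ^ m)⁻¹ * Q ^ i)) /
          ∏ i ∈ Finset.range m, (1 - Q * Q ^ i) = ρ at tel hρ
    have hx1 : CongMod V (1 - x) x 1 := ⟨hx, V.one_mem, -1, V.neg_mem V.one_mem, by ring⟩
    have hx2 : CongMod V (1 - x) x⁻¹ 1 := ⟨hxi, V.one_mem, x⁻¹, hxi, by field_simp; ring⟩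
    have hqV : ∀ k, (Q ^ k)⁻¹ ∈ V := fun k => by rw [← inv_pow]; exact V.pow_mem hQi _
    have hcV : (-1 : K) ^ (m + 1) * Q ^ (m + 1 + 1).choose 2 * (1 - Q ^ (m + 1))⁻¹ ^ 3 ∈ V :=
      V.mul_mem (V.mul_mem (V.pow_mem (V.neg_mem V.one_mem) _) (V.pow_mem hQ _))
        (V.pow_mem hmV _)
    obtain ⟨c, hc⟩ : ∃ c, c = Q ^ (m + 1).choose 2 := ⟨_, rfl⟩
    have hcV' : c ∈ V := hc ▸ V.pow_mem hQ _
    have hc0 : c ≠ 0 := hc ▸ pow_ne_zero _ hQ0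
    have hc1 : Q ^ (m + 1 + 1).choose 2 = c * (Q ^ m * Q) := by
      rw [choose_two_step, pow_add, hc, pow_succ]
    have hc2 : Q ^ (m * (m + 1)) = c ^ 2 := by
      rw [hc, ← pow_mul, Nat.choose_two_right, Nat.div_mul_cancel, mul_comm, Nat.add_sub_cancel]
      exact (Nat.even_mul_pred_self _).two_dvd
    have hApow : ((x * (Q ^ m)⁻¹) ^ (m + 1))⁻¹ = x⁻¹ ^ (m + 1) * c ^ 2 := by
      rw [← hc2, pow_mul, mul_pow, mul_inv, inv_pow, inv_pow, inv_inv]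
    have hBpow : ((x * (Q ^ (m + 1))⁻¹) ^ (m + 1))⁻¹ =
        x⁻¹ ^ (m + 1) * (c ^ 2 * (Q ^ m * Q)) := by
      rw [← hc2, mul_pow, mul_inv, inv_pow, inv_pow, inv_inv]; ring
    -- the cubic coefficient contributed by the step, and its value at `x = 1`
    have key := ((CongMod.refl hcV).mul (hρ.pow 3)).mul
      (((CongMod.refl (V.mul_mem (V.pow_mem hcV' 2) (V.mul_mem (V.pow_mem hQ m) hQ))).mul
        ((hx2.pow (m + 1)).mul
        ((CongMod.refl V.one_mem).sub ((hx1.pow 2).mul (CongMod.refl (hqV m)))))).sub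
      ((CongMod.refl (V.mul_mem (hqV (m + 1)) (V.pow_mem hcV' 2))).mul
        ((hx1.mul (hx2.pow (m + 1))).mul
          ((CongMod.refl V.one_mem).sub (hx1.mul (CongMod.refl (V.pow_mem hQ (m + 2))))))))
    have hc2V : (1 + Q ^ (m + 1)) * (1 - Q ^ (m + 1))⁻¹ ^ 2 ∈ V :=
      V.mul_mem (V.add_mem V.one_mem (V.pow_mem hQ _)) (V.pow_mem hmV _)
    obtain ⟨-, -, w, hw, hE⟩ := key
    have hy : Q ^ m ≠ 0 := pow_ne_zero _ hQ0
    have hs : (-1 : K) ^ m = 1 ∨ (-1 : K) ^ m = -1 := neg_one_pow_eq_or K m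
    -- This value is the new summand of the cubic coefficient times the outer prefactor for `m + 1`
    -- at `x = 1`: sign and power of `Q` cancel.
    have hsum : (-1 : K) ^ (m + 1) * Q ^ (m + 1 + 1).choose 2 * (1 - Q ^ (m + 1))⁻¹ ^ 3 *
        ((-1) ^ m * (Q ^ (m + 1).choose 2)⁻¹) ^ 3 *
        (c ^ 2 * (Q ^ m * Q) * (1 ^ (m + 1) * (1 - 1 ^ 2 * (Q ^ m)⁻¹)) -
          (Q ^ (m + 1))⁻¹ * c ^ 2 * (1 * 1 ^ (m + 1) * (1 - 1 * Q ^ (m + 2)))) =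
        (1 + Q ^ (m + 1)) * (1 - Q ^ (m + 1))⁻¹ ^ 2 := by
      have h1 : Q ^ (m + 1) = Q ^ m * Q := pow_succ _ _
      have h2 : Q ^ (m + 2) = Q ^ m * Q ^ 2 := pow_add _ _ _
      rw [hc1, ← hc, pow_succ (-1 : K), h2]
      simp only [one_pow]
      rw [h1] at hm ⊢
      generalize Q ^ m = y at *
      rcases hs with hs | hs <;> rw [hs] <;> field_simp <;> ring
    rw [hsum] at hE
    obtain ⟨-, -, z, hz, hxE⟩ := (hx1.pow (m + 1)).mul (CongMod.refl hc2V)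
    rw [one_pow, one_mul] at hxE
    -- Here `w` is the error of setting `x = 1` in the cubic contribution, `z` that of replacing
    -- `x^(m+1)` by `1` in the target, and the old error `u` returns multiplied by `-B`.
    refine ⟨w - z - x * (Q ^ (m + 1))⁻¹ * u, V.sub_mem (V.sub_mem hw hz) (V.mul_mem hBV hu), ?_⟩
    rw [Finset.sum_Icc_succ_top (by omega)]
    rw [hApow, hBpow] at tel
    generalize ∑ k ∈ Finset.range (m + 1 + 1), wellPoisedTerm (x * (Q ^ (m + 1))⁻¹) Q k = P at *
    generalize ∑ k ∈ Finset.Icc 1 m,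
      (-1) ^ k * Q ^ (k + 1).choose 2 * (1 + Q ^ k) / (1 - Q ^ k) ^ 2 = H at *
    clear ih hT hG hApow hBpow hsum hρ hcV hc2V hA hAx
    have h1 : Q ^ (m + 1) = Q ^ m * Q := pow_succ _ _
    have h2 : Q ^ (m + 2) = Q ^ m * Q ^ 2 := pow_add _ _ _
    have h3 : Q ^ (m + 1 + 1) = Q ^ m * Q ^ 2 := by ring
    have h4 : Q ^ (2 * (m + 1)) = (Q ^ m) ^ 2 * Q ^ 2 := by ring
    have h5 : x ^ (m + 1) = x ^ m * x := pow_succ _ _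
    rw [hc1, h1, h2, pow_succ (-1 : K)] at hE
    rw [hc1, h1, h3, h4, ← hc, pow_succ (-1 : K)] at tel
    rw [h1, h5] at hxE
    rw [hc1, h1, h5, pow_succ (-1 : K)]
    rw [h1] at hm
    generalize x⁻¹ ^ (m + 1) = Z at *
    generalize Q ^ m = y at *
    generalize x ^ m = X at *
    rw [← sub_eq_zero] at tel hE hxE ⊢
    have hfin := congrArg₂ (· + ·) tel (congrArg ((1 - x) ^ 3 * ·) (congrArg₂ (· - ·) hE hxE))
    refine Eq.trans ?_ (hfin.trans (by simp))
    clear hfin tel hE hxE hc1 hc2 h1 h2 h3 h4 h5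
    rcases hs with hs | hs <;> rw [hs] <;> field_simp <;> ring

end Expansion

/-! ### Cancellation under `k ↦ a + b - k` when `A Q^(a+b) = 1`. -/

section Reflection

variable {F : Type*} [Field F]

/-- The recurrence satisfied by `Q ^ k` times the cubed part of the well-poised terms. -/
def WellPoisedRec {R : Type*} [CommRing R] (A Q : R) (s : ℕ → R) (k : ℕ) : Prop :=
  A * (s (k + 1) * (1 - Q ^ (k + 1)) ^ 3) = -(Q ^ (k + 2) * (1 - A * Q ^ k) ^ 3 * s k)

variable {A Q : F} {s : ℕ → F} {a b : ℕ}

theorem WellPoisedRec.reflected (hQ : Q ≠ 0) (hA : A * Q ^ (a + b) = 1) {i j : ℕ}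
    (hij : i + j = a + b) (h : WellPoisedRec A Q s i) :
    s (i + 1) * (1 - Q ^ (i + 1)) ^ 3 * Q ^ (2 * j) = Q ^ (2 * i + 2) * (1 - Q ^ j) ^ 3 * s i := by
  rw [← hij, pow_add] at hA
  rw [WellPoisedRec] at h
  have hj : Q ^ j ≠ 0 := pow_ne_zero _ hQ
  have hi : Q ^ i ≠ 0 := pow_ne_zero _ hQ
  have hA' : A = (Q ^ i)⁻¹ * (Q ^ j)⁻¹ := by field_simp; linear_combination hA
  subst hA'
  have e1 : Q ^ (2 * j) = (Q ^ j) ^ 2 := by ring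
  have e2 : Q ^ (2 * i + 2) = (Q ^ i) ^ 2 * Q ^ 2 := by ring
  rw [pow_add Q i 2] at h
  rw [e1, e2]
  generalize (1 - Q ^ (i + 1)) = u at *
  generalize Q ^ i = y at *
  generalize Q ^ j = z at *
  field_simp at h
  linear_combination h

/-- By `WellPoisedRec.reflected` the ratios `s (i+1) / s i` and `s (l+1) / s l` are reciprocal when
`i + l + 1 = a + b`, so equality at the inner pair `(i+1, l)` passes to `(i, l+1)`. The gap grows by
two; gap one follows from a single use of the recurrence. -/
theorem wellPoisedRec_symm (hQ : Q ≠ 0) (hA : A * Q ^ (a + b) = 1)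
    (hrec : ∀ k, a ≤ k → k < b → WellPoisedRec A Q s k)
    (hne : ∀ k, a ≤ k → k < b → 1 - Q ^ (k + 1) ≠ 0) (t : ℕ) :
    ∀ i j, a ≤ i → i + j = a + b → j = i + t → s i = s j := by
  induction t using Nat.twoStepInduction with
  | zero => rintro i j - - rfl; rfl
  | one =>
    rintro i j hi hij rfl
    have h := (hrec i hi (by omega)).reflected hQ hA hij
    have hn := hne i hi (by omega)
    have hq : Q ^ (2 * i + 2) ≠ 0 := pow_ne_zero _ hQ
    rw [mul_add, mul_one] at h
    refine mul_left_cancel₀ (mul_ne_zero hq (pow_ne_zero 3 hn)) ?_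
    linear_combination -h
  | more t ih _ =>
    intro i j hi hij hj
    obtain ⟨l, rfl⟩ : ∃ l, j = l + 1 := ⟨j - 1, by omega⟩
    have h := ih (i + 1) l (by omega) (by omega) (by omega)
    have h1 := (hrec i hi (by omega)).reflected hQ hA hij
    have h2 := (hrec l (by omega) (by omega)).reflected hQ hA (j := i + 1) (by omega)
    have hn1 := hne i hi (by omega)
    have hn2 := hne l (by omega) (by omega)
    have hq : Q ^ (2 * i + 2) ≠ 0 := pow_ne_zero _ hQ
    rw [mul_add, mul_one] at h1 h2
    refine mul_left_cancel₀ (mul_ne_zero hq (pow_ne_zero 3 hn2)) ?_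
    linear_combination -h1 - h2 + (1 - Q ^ (i + 1)) ^ 3 * Q ^ (2 * l + 2) * h

/-- With `j = a + b - k`, the weight is `Q^(-k) - A Q^k = Q^(-k) - Q^(-j)`, which is antisymmetric,
whereas `s` is symmetric. The sum is therefore its own negative. -/
theorem sum_wellPoisedRec_eq_zero (h2 : (2 : F) ≠ 0) (hQ : Q ≠ 0)
    (hA : A * Q ^ (a + b) = 1)
    (hrec : ∀ k, a ≤ k → k < b → WellPoisedRec A Q s k)
    (hne : ∀ k, a ≤ k → k < b → 1 - Q ^ (k + 1) ≠ 0) :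
    ∑ k ∈ Finset.Ico a (b + 1), s k * ((Q ^ k)⁻¹ * (1 - A * Q ^ (2 * k))) = 0 := by
  have hanti : ∑ k ∈ Finset.Ico a (b + 1), s k * ((Q ^ k)⁻¹ * (1 - A * Q ^ (2 * k))) =
      ∑ k ∈ Finset.Ico a (b + 1), -(s k * ((Q ^ k)⁻¹ * (1 - A * Q ^ (2 * k)))) := by
    refine Finset.sum_bij' (fun k _ => a + b - k) (fun k _ => a + b - k) ?_ ?_ ?_ ?_ ?_
    · intro k hk; simp only [Finset.mem_Ico] at *; omega
    · intro k hk; simp only [Finset.mem_Ico] at *; omega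
    · intro k hk; simp only [Finset.mem_Ico] at *; omega
    · intro k hk; simp only [Finset.mem_Ico] at *; omega
    · intro k hk
      rw [Finset.mem_Ico] at hk
      obtain ⟨j, hj⟩ : ∃ j, j = a + b - k := ⟨_, rfl⟩
      have hkj : k + j = a + b := by omega
      rw [← hj]
      have hs : s k = s j := by
        rcases le_total k j with h | h
        · exact wellPoisedRec_symm hQ hA hrec hne (j - k) k j hk.1 hkj (by omega)
        · exact (wellPoisedRec_symm hQ hA hrec hne (k - j) j k (by omega) (by omega)
            (by omega)).symm
      rw [← hkj, pow_add] at hA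
      have hj0 : Q ^ j ≠ 0 := pow_ne_zero _ hQ
      have hk0 : Q ^ k ≠ 0 := pow_ne_zero _ hQ
      have hA' : A = (Q ^ k)⁻¹ * (Q ^ j)⁻¹ := by field_simp; linear_combination hA
      rw [hs, hA', mul_comm 2 k, mul_comm 2 j, pow_mul, pow_mul]
      field_simp
      ring
  rw [Finset.sum_neg_distrib] at hanti
  have h : 2 * ∑ k ∈ Finset.Ico a (b + 1), s k * ((Q ^ k)⁻¹ * (1 - A * Q ^ (2 * k))) = 0 := by
    linear_combination hanti
  exact (mul_eq_zero.1 h).resolve_left h2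

/-- At a primitive `e`-th root of unity the full series of blocks of length `e`, with the last
block possibly cut at `l`, vanishes. -/
theorem sum_wellPoisedRec_blocks (h2 : (2 : F) ≠ 0) (hQ : Q ≠ 0) {e l : ℕ}
    (hl : l < e) (hQe : ∀ j, Q ^ j = 1 ↔ e ∣ j) (hA : A * Q ^ l = 1)
    (hrec : ∀ k, WellPoisedRec A Q s k) (c M : ℕ) (hM : M = c * e + l ∨ M = c * e + (e - 1)) :
    ∑ k ∈ Finset.range (M + 1), s k * ((Q ^ k)⁻¹ * (1 - A * Q ^ (2 * k))) = 0 := by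
  have hA0 : A ≠ 0 := left_ne_zero_of_mul_eq_one hA
  have hper : ∀ c j, Q ^ (c * e + j) = Q ^ j := fun c j => by
    rw [pow_add, (hQe _).2 (Dvd.intro_left c rfl), one_mul]
  have hne : ∀ c j, j + 1 < e → 1 - Q ^ (c * e + j + 1) ≠ 0 := fun c j hj h => by
    rw [add_assoc, hper, sub_eq_zero, eq_comm, hQe] at h
    exact absurd (Nat.le_of_dvd j.succ_pos h) (by omega)
  -- Reflection with `a = ce`, `b = ce + l`; periodicity of the powers of `Q` gives `A Q^(a+b) = A
  -- Q^l = 1`.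
  have hhead : ∀ c, ∑ k ∈ Finset.Ico (c * e) (c * e + l + 1),
      s k * ((Q ^ k)⁻¹ * (1 - A * Q ^ (2 * k))) = 0 := fun c => by
    refine sum_wellPoisedRec_eq_zero h2 hQ ?_ (fun k _ _ => hrec k) ?_
    · rw [hper, hper, hA]
    · intro k hk hk'
      obtain ⟨j, rfl⟩ := Nat.exists_eq_add_of_le hk
      exact hne c j (by omega)
  -- The factor `1 - A Q^(ce+l)` vanishes, and the recurrence carries the resulting zero to the end
  -- of the block, where `1 - Q^(k+1) = 0` stops it.
  have hzero : ∀ c j, l + 1 + j < e → s (c * e + (l + 1 + j)) = 0 := fun c j => by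
    induction j with
    | zero =>
      intro hj
      have h := hrec (c * e + l)
      rw [WellPoisedRec, hper, hA, sub_self] at h
      have h := hne c l hj
      simp_all [add_assoc]
    | succ j ih =>
      intro hj
      have h := hrec (c * e + (l + 1 + j))
      rw [WellPoisedRec, ih (by omega), mul_zero, neg_zero] at h
      have h' := hne c (l + 1 + j) hj
      rw [← add_assoc] at h
      rw [show c * e + (l + 1 + (j + 1)) = c * e + (l + 1 + j) + 1 by ring]
      rw [mul_eq_zero, mul_eq_zero, pow_eq_zero_iff three_ne_zero] at h
      rw [← add_assoc, ← add_assoc] at h' ⊢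
      exact (h.resolve_left hA0).resolve_right h'
  have htail : ∀ c, ∑ k ∈ Finset.Ico (c * e + l + 1) (c * e + (e - 1) + 1),
      s k * ((Q ^ k)⁻¹ * (1 - A * Q ^ (2 * k))) = 0 := fun c => by
    refine Finset.sum_eq_zero fun k hk => ?_
    rw [Finset.mem_Ico] at hk
    obtain ⟨j, rfl⟩ : ∃ j, k = c * e + (l + 1 + j) := ⟨k - (c * e + (l + 1)), by omega⟩
    rw [hzero c j (by omega), zero_mul]
  have hblock : ∀ c, ∑ k ∈ Finset.Ico (c * e) (c * e + (e - 1) + 1),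
      s k * ((Q ^ k)⁻¹ * (1 - A * Q ^ (2 * k))) = 0 := fun c => by
    rw [← Finset.sum_Ico_consecutive _ (show c * e ≤ c * e + l + 1 by omega) (by omega),
      hhead, htail, add_zero]
  have hfull : ∀ c, ∑ k ∈ Finset.range (c * e),
      s k * ((Q ^ k)⁻¹ * (1 - A * Q ^ (2 * k))) = 0 := fun c => by
    induction c with
    | zero => simp
    | succ c ih =>
      rw [← Finset.sum_range_add_sum_Ico _ (show c * e ≤ (c + 1) * e by gcongr; omega), ih,
        zero_add]
      have h := hblock c
      rwa [show c * e + (e - 1) + 1 = (c + 1) * e by rw [add_mul]; omega] at h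
  rcases hM with rfl | rfl
  · rw [← Finset.sum_range_add_sum_Ico _ (show c * e ≤ c * e + l + 1 by omega), hfull, hhead,
      add_zero]
  · rw [← Finset.sum_range_add_sum_Ico _ (show c * e ≤ c * e + (e - 1) + 1 by omega), hfull,
      hblock, add_zero]

end Reflection

/-! ### Passage to the residue field of a valuation. -/

section Reduction

open IsLocalRing

variable {K Γ : Type*} [Field K] [LinearOrderedCommGroupWithZero Γ] (v : Valuation K Γ)

open scoped Classical in
/-- Reduction to the residue field of a valuation, extended by `0` to non-integral elements. -/
def valReduce (x : K) : ResidueField v.valuationSubring :=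
  if h : v x ≤ 1 then residue v.valuationSubring ⟨x, h⟩ else 0

variable {v} {x y : K}

theorem valReduce_of_le (h : v x ≤ 1) : valReduce v x = residue v.valuationSubring ⟨x, h⟩ :=
  dif_pos h

theorem valReduce_eq_zero_iff (h : v x ≤ 1) : valReduce v x = 0 ↔ v x < 1 := by
  rw [valReduce_of_le h, residue_eq_zero_iff, mem_maximalIdeal, mem_nonunits_iff, lt_iff_le_and_ne,
    and_iff_right h, not_iff_not]
  constructor
  · rintro ⟨u, hu⟩
    have h1 : v (u : v.valuationSubring) ≤ 1 := u.val.2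
    have h2 : v ((u⁻¹ : v.valuationSubringˣ) : v.valuationSubring) ≤ 1 := u⁻¹.val.2
    have h3 : v (u : v.valuationSubring) * v ((u⁻¹ : v.valuationSubringˣ) : v.valuationSubring) = 1 := by
      rw [← map_mul, ← MulMemClass.coe_mul, Units.mul_inv]; exact map_one v
    rw [show x = ((u : v.valuationSubring) : K) by rw [hu]]
    exact le_antisymm h1 (h3 ▸ mul_le_of_le_one_right' h2)
  · intro h1
    have hx : x ≠ 0 := by rintro rfl; simp at h1
    refine IsUnit.of_mul_eq_one ⟨x⁻¹, ?_⟩ (Subtype.ext (mul_inv_cancel₀ hx))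
    rw [Valuation.mem_valuationSubring_iff, map_inv₀, h1, inv_one]

theorem valReduce_one : valReduce v (1 : K) = 1 := by
  rw [valReduce_of_le (map_one v).le]; exact map_one _

theorem map_pow_le_one (hx : v x ≤ 1) (k : ℕ) : v (x ^ k) ≤ 1 := by
  rw [map_pow]; exact pow_le_one' hx k

theorem map_mul_le_one (hx : v x ≤ 1) (hy : v y ≤ 1) : v (x * y) ≤ 1 := by
  rw [map_mul]; exact mul_le_one' hx hy

theorem map_sub_le_one (hx : v x ≤ 1) (hy : v y ≤ 1) : v (x - y) ≤ 1 :=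
  (v.map_sub x y).trans (max_le hx hy)

theorem valReduce_mul (hx : v x ≤ 1) (hy : v y ≤ 1) :
    valReduce v (x * y) = valReduce v x * valReduce v y := by
  rw [valReduce_of_le hx, valReduce_of_le hy,
    valReduce_of_le (map_mul_le_one hx hy), ← map_mul]
  rfl

theorem valReduce_sub (hx : v x ≤ 1) (hy : v y ≤ 1) :
    valReduce v (x - y) = valReduce v x - valReduce v y := by
  rw [valReduce_of_le hx, valReduce_of_le hy,
    valReduce_of_le ((v.map_sub x y).trans (max_le hx hy)), ← map_sub]
  rfl

theorem valReduce_add (hx : v x ≤ 1) (hy : v y ≤ 1) :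
    valReduce v (x + y) = valReduce v x + valReduce v y := by
  rw [valReduce_of_le hx, valReduce_of_le hy,
    valReduce_of_le ((v.map_add x y).trans (max_le hx hy)), ← map_add]
  rfl

theorem valReduce_neg (hx : v x ≤ 1) : valReduce v (-x) = -valReduce v x := by
  rw [valReduce_of_le hx, valReduce_of_le ((v.map_neg x).trans_le hx), ← map_neg]
  rfl

theorem valReduce_pow (hx : v x ≤ 1) (k : ℕ) : valReduce v (x ^ k) = valReduce v x ^ k := by
  induction k with
  | zero => simpa using valReduce_one
  | succ k ih => rw [pow_succ, pow_succ, valReduce_mul (map_pow_le_one hx k) hx, ih]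

theorem valReduce_inv (hx : v x = 1) : valReduce v x⁻¹ = (valReduce v x)⁻¹ := by
  have h0 : x ≠ 0 := by rintro rfl; simp at hx
  refine eq_inv_of_mul_eq_one_left ?_
  rw [← valReduce_mul (by rw [map_inv₀, hx, inv_one]) hx.le, inv_mul_cancel₀ h0, valReduce_one]

theorem valReduce_sum {ι : Type*} (t : Finset ι) (f : ι → K) (hf : ∀ i ∈ t, v (f i) ≤ 1) :
    valReduce v (∑ i ∈ t, f i) = ∑ i ∈ t, valReduce v (f i) := by
  classical
  induction t using Finset.induction_on with
  | empty => rw [Finset.sum_empty, Finset.sum_empty, valReduce_eq_zero_iff] <;> simp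
  | insert i t hi ih =>
    rw [Finset.sum_insert hi, Finset.sum_insert hi, valReduce_add (hf i (Finset.mem_insert_self i t))
      (v.map_sum_le fun j hj => hf j (Finset.mem_insert_of_mem hj)),
      ih fun j hj => hf j (Finset.mem_insert_of_mem hj)]

variable {A Q : K} {s : ℕ → K}

/-- Because the recurrence is free of division, it survives reduction even where `1 - Q^(k+1)`
becomes zero. -/
theorem WellPoisedRec.reduce {k : ℕ} (hA : v A ≤ 1) (hQ : v Q ≤ 1) (hs : v (s k) ≤ 1)
    (hs' : v (s (k + 1)) ≤ 1) (h : WellPoisedRec A Q s k) :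
    WellPoisedRec (valReduce v A) (valReduce v Q) (fun k => valReduce v (s k)) k := by
  have h1 : v (1 : K) ≤ 1 := (map_one v).le
  have hp := map_pow_le_one hQ
  have hu := map_sub_le_one h1 (hp (k + 1))
  have hw := map_sub_le_one h1 (map_mul_le_one hA (hp k))
  have h' := congrArg (valReduce v) h
  rw [valReduce_neg (map_mul_le_one (map_mul_le_one (hp _) (map_pow_le_one hw 3)) hs),
    valReduce_mul hA (map_mul_le_one hs' (map_pow_le_one hu 3)),
    valReduce_mul hs' (map_pow_le_one hu 3),
    valReduce_mul (map_mul_le_one (hp _) (map_pow_le_one hw 3)) hs,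
    valReduce_mul (hp _) (map_pow_le_one hw 3), valReduce_pow hu, valReduce_pow hw,
    valReduce_sub h1 (hp _), valReduce_sub h1 (map_mul_le_one hA (hp k)),
    valReduce_mul hA (hp k), valReduce_pow hQ, valReduce_pow hQ, valReduce_pow hQ,
    valReduce_one] at h'
  exact h'

theorem integral_wellPoised {k : ℕ} (hA : v A ≤ 1) (hQ : v Q = 1) (hs : v (s k) ≤ 1) :
    v (s k * ((Q ^ k)⁻¹ * (1 - A * Q ^ (2 * k)))) ≤ 1 := by
  refine map_mul_le_one hs (map_mul_le_one ?_ (map_sub_le_one (map_one v).le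
    (map_mul_le_one hA (map_pow_le_one hQ.le _))))
  rw [map_inv₀, map_pow, hQ, one_pow, inv_one]

theorem valReduce_wellPoised_sum (hA : v A ≤ 1) (hQ : v Q = 1) (t : Finset ℕ)
    (hs : ∀ k ∈ t, v (s k) ≤ 1) :
    valReduce v (∑ k ∈ t, s k * ((Q ^ k)⁻¹ * (1 - A * Q ^ (2 * k)))) =
      ∑ k ∈ t, valReduce v (s k) * ((valReduce v Q ^ k)⁻¹ *
        (1 - valReduce v A * valReduce v Q ^ (2 * k))) := by
  rw [valReduce_sum _ _ fun k hk => integral_wellPoised hA hQ (hs k hk)]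
  refine Finset.sum_congr rfl fun k hk => ?_
  have h1 : v (1 : K) ≤ 1 := (map_one v).le
  have hp := map_pow_le_one hQ.le
  have hk1 : v (Q ^ k) = 1 := by rw [map_pow, hQ, one_pow]
  have hi : v (Q ^ k)⁻¹ ≤ 1 := by rw [map_inv₀, hk1, inv_one]
  have hw := map_sub_le_one h1 (map_mul_le_one hA (hp (2 * k)))
  rw [valReduce_mul (hs k hk) (map_mul_le_one hi hw), valReduce_mul hi hw, valReduce_inv hk1,
    valReduce_sub h1 (map_mul_le_one hA (hp _)), valReduce_mul hA (hp _), valReduce_pow hQ.le,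
    valReduce_pow hQ.le, valReduce_one]

theorem valReduce_one_sub_mul_pow (hA : v A ≤ 1) (hQ : v Q ≤ 1) (k : ℕ) :
    1 - valReduce v A * valReduce v Q ^ k = valReduce v (1 - A * Q ^ k) := by
  have hp := map_pow_le_one hQ
  rw [valReduce_sub (map_one v).le (map_mul_le_one hA (hp _)), valReduce_mul hA (hp _),
    valReduce_pow hQ, valReduce_one]

theorem one_sub_mul_pow_reduce (hA : v A ≤ 1) (hQ : v Q ≤ 1) (k : ℕ) :
    valReduce v A * valReduce v Q ^ k = 1 ↔ v (1 - A * Q ^ k) < 1 := by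
  rw [← valReduce_eq_zero_iff (map_sub_le_one (map_one v).le
      (map_mul_le_one hA (map_pow_le_one hQ _))), ← valReduce_one_sub_mul_pow hA hQ, sub_eq_zero,
    eq_comm]

theorem pow_reduce_eq_one_iff (hQ : v Q ≤ 1) (k : ℕ) :
    valReduce v Q ^ k = 1 ↔ v (1 - Q ^ k) < 1 := by
  simpa [valReduce_one] using one_sub_mul_pow_reduce (A := 1) (map_one v).le hQ k

theorem valReduce_two_ne_zero (h2 : v (2 : K) = 1) :
    (2 : ResidueField v.valuationSubring) ≠ 0 := by
  have h1 : v (1 : K) ≤ 1 := (map_one v).le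
  rw [← one_add_one_eq_two, ← valReduce_one, ← valReduce_add h1 h1, one_add_one_eq_two, Ne,
    valReduce_eq_zero_iff h2.le, h2]
  exact lt_irrefl _

theorem valReduce_ne_zero (h : v x = 1) : valReduce v x ≠ 0 := by
  rw [Ne, valReduce_eq_zero_iff h.le, h]
  exact lt_irrefl _

theorem map_sum_wellPoisedRec_lt_one (h2 : v (2 : K) = 1) (hA : v A ≤ 1) (hQ : v Q = 1) {a b : ℕ}
    (hAQ : v (1 - A * Q ^ (a + b)) < 1) (hs : ∀ k, a ≤ k → k ≤ b → v (s k) ≤ 1)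
    (hrec : ∀ k, a ≤ k → k < b → WellPoisedRec A Q s k)
    (hne : ∀ k, a ≤ k → k < b → v (1 - Q ^ (k + 1)) = 1) :
    v (∑ k ∈ Finset.Ico a (b + 1), s k * ((Q ^ k)⁻¹ * (1 - A * Q ^ (2 * k)))) < 1 := by
  have hs' : ∀ k ∈ Finset.Ico a (b + 1), v (s k) ≤ 1 := fun k hk => by
    rw [Finset.mem_Ico] at hk; exact hs k hk.1 (by omega)
  rw [← valReduce_eq_zero_iff (v.map_sum_le fun k hk => integral_wellPoised hA hQ (hs' k hk)),
    valReduce_wellPoised_sum hA hQ _ hs']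
  refine sum_wellPoisedRec_eq_zero (s := fun k => valReduce v (s k)) (valReduce_two_ne_zero h2)
    (valReduce_ne_zero hQ) ((one_sub_mul_pow_reduce hA hQ.le _).2 hAQ)
    (fun k h1 h2 => (hrec k h1 h2).reduce hA hQ.le (hs k h1 h2.le) (hs _ (by omega) h2))
    fun k h1 h2 h => ?_
  rw [sub_eq_zero, eq_comm, pow_reduce_eq_one_iff hQ.le, hne k h1 h2] at h
  exact lt_irrefl _ h

theorem map_sum_wellPoisedRec_blocks_lt_one (h2 : v (2 : K) = 1) (hA : v A ≤ 1) (hQ : v Q = 1)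
    {e l : ℕ} (hl : l < e) (hQe : ∀ j, v (1 - Q ^ j) < 1 ↔ e ∣ j) (hAQ : v (1 - A * Q ^ l) < 1)
    (hs : ∀ k, v (s k) ≤ 1) (hrec : ∀ k, WellPoisedRec A Q s k) (c M : ℕ)
    (hM : M = c * e + l ∨ M = c * e + (e - 1)) :
    v (∑ k ∈ Finset.range (M + 1), s k * ((Q ^ k)⁻¹ * (1 - A * Q ^ (2 * k)))) < 1 := by
  rw [← valReduce_eq_zero_iff (v.map_sum_le fun k hk => integral_wellPoised hA hQ (hs k)),
    valReduce_wellPoised_sum hA hQ _ fun k _ => hs k]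
  exact sum_wellPoisedRec_blocks (s := fun k => valReduce v (s k)) (valReduce_two_ne_zero h2)
    (valReduce_ne_zero hQ) hl (fun j => (pow_reduce_eq_one_iff hQ.le j).trans (hQe j))
    ((one_sub_mul_pow_reduce hA hQ.le _).2 hAQ)
    (fun k => (hrec k).reduce hA hQ.le (hs k) (hs _)) c M hM

end Reduction

/-! ### The recurrence for the well-poised terms. -/

section Recurrence

variable {K : Type*} [Field K]

/-- The quotient `(A; Q)_k / (Q; Q)_k`. -/
def qPochRatio (A Q : K) (k : ℕ) : K :=
  (∏ i ∈ Finset.range k, (1 - A * Q ^ i)) / ∏ i ∈ Finset.range k, (1 - Q * Q ^ i)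

/-- The well-poised term without its linear factor, multiplied by `Q ^ k`. -/
def wellPoisedCore (A Q : K) (k : ℕ) : K :=
  (-1) ^ k * Q ^ ((k + 1).choose 2 + k) * (A ^ k)⁻¹ * qPochRatio A Q k ^ 3

theorem wellPoisedTerm_eq_core {A Q : K} (hQ : Q ≠ 0) (k : ℕ) :
    wellPoisedTerm A Q k = wellPoisedCore A Q k * ((Q ^ k)⁻¹ * (1 - A * Q ^ (2 * k))) := by
  rw [wellPoisedTerm, wellPoisedCore, qPochRatio, pow_add]
  field_simp

theorem wellPoisedRec_core {A Q : K} (hA : A ≠ 0) {k : ℕ} (hk : 1 - Q ^ (k + 1) ≠ 0) :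
    WellPoisedRec A Q (wellPoisedCore A Q) k := by
  have h1 : qPochRatio A Q (k + 1) * (1 - Q ^ (k + 1)) = qPochRatio A Q k * (1 - A * Q ^ k) := by
    rw [qPochRatio, qPochRatio, Finset.prod_range_succ, Finset.prod_range_succ _ k, ← pow_succ',
      div_eq_mul_inv, div_eq_mul_inv, mul_inv]
    linear_combination (∏ x ∈ Finset.range k, (1 - A * Q ^ x)) * (1 - A * Q ^ k) *
      (∏ i ∈ Finset.range k, (1 - Q * Q ^ i))⁻¹ * inv_mul_cancel₀ hk
  have h2 : Q ^ ((k + 1 + 1).choose 2 + (k + 1)) = Q ^ (k + 2) * Q ^ ((k + 1).choose 2 + k) := by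
    rw [choose_two_step]; ring
  have h3 : A * (A ^ (k + 1))⁻¹ = (A ^ k)⁻¹ := by rw [pow_succ]; field_simp
  rw [WellPoisedRec, wellPoisedCore, wellPoisedCore, h2]
  have h1' := congrArg (· ^ 3) h1
  simp only [mul_pow] at h1'
  linear_combination ((-1) ^ (k + 1) * (Q ^ (k + 2) * Q ^ ((k + 1).choose 2 + k)) *
    qPochRatio A Q (k + 1) ^ 3 * (1 - Q ^ (k + 1)) ^ 3) * h3 +
    ((-1) ^ (k + 1) * (Q ^ (k + 2) * Q ^ ((k + 1).choose 2 + k)) * (A ^ k)⁻¹) * h1'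

end Recurrence

/-! ### Integrality and vanishing at a cyclotomic valuation. -/

section Valuation

variable {K Γ : Type*} [Field K] [LinearOrderedCommGroupWithZero Γ]

/-- The properties of the `Φ_e(q)`-adic valuation of `ℚ(q)` that concern the elements `1 - q ^ j`. -/
structure IsCyclotomicVal (v : Valuation K Γ) (q : K) (e : ℕ) : Prop where
  pos : 0 < e
  two : v 2 = 1
  base : v q = 1
  lt_one_iff : ∀ j : ℤ, v (1 - q ^ j) < 1 ↔ (e : ℤ) ∣ j
  eq_of_dvd : ∀ j : ℤ, j ≠ 0 → (e : ℤ) ∣ j → v (1 - q ^ j) = v (1 - q ^ (e : ℤ))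
  ne_zero : v (1 - q ^ (e : ℤ)) ≠ 0

theorem exists_lt_dvd_add_mul {d e : ℕ} (he : 0 < e) (hde : Nat.Coprime d e) (r : ℤ) :
    ∃ i < e, (e : ℤ) ∣ r + d * i := by
  obtain ⟨a, b, hab⟩ := Nat.isCoprime_iff_coprime.2 hde
  have he' : (e : ℤ) ≠ 0 := by exact_mod_cast he.ne'
  have h0 := Int.emod_nonneg (-r * a) he'
  have h1 := Int.emod_lt_of_pos (-r * a) (by exact_mod_cast he : (0 : ℤ) < e)
  refine ⟨((-r * a) % e).toNat, by omega, ?_⟩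
  rw [Int.toNat_of_nonneg h0, Int.emod_def]
  exact ⟨r * b - d * (-r * a / e), by linear_combination (-r) * hab⟩

namespace IsCyclotomicVal

variable {v : Valuation K Γ} {q : K} {e : ℕ}

theorem q_ne_zero (h : IsCyclotomicVal v q e) : q ≠ 0 := by
  rintro rfl; simpa using h.base

theorem zpow_eq_one (h : IsCyclotomicVal v q e) (j : ℤ) : v (q ^ j) = 1 := by
  rw [map_zpow₀, h.base, one_zpow]

theorem le_one (h : IsCyclotomicVal v q e) (j : ℤ) : v (1 - q ^ j) ≤ 1 :=
  map_sub_le_one (map_one v).le (h.zpow_eq_one j).le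

theorem eq_one (h : IsCyclotomicVal v q e) {j : ℤ} (hj : ¬(e : ℤ) ∣ j) : v (1 - q ^ j) = 1 :=
  le_antisymm (h.le_one j) (not_lt.1 (mt (h.lt_one_iff j).1 hj))

theorem le_of_dvd (h : IsCyclotomicVal v q e) {j : ℤ} (hj : (e : ℤ) ∣ j) :
    v (1 - q ^ j) ≤ v (1 - q ^ (e : ℤ)) := by
  rcases eq_or_ne j 0 with rfl | h0
  · simp
  · exact (h.eq_of_dvd j h0 hj).le

theorem le_of_ne_zero (h : IsCyclotomicVal v q e) {j : ℤ} (hj : j ≠ 0) :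
    v (1 - q ^ (e : ℤ)) ≤ v (1 - q ^ j) := by
  by_cases hd : (e : ℤ) ∣ j
  · exact (h.eq_of_dvd j hj hd).ge
  · rw [h.eq_one hd]; exact h.le_one _

theorem one_sub_ne_zero (h : IsCyclotomicVal v q e) {j : ℤ} (hj : j ≠ 0) : 1 - q ^ j ≠ 0 :=
  fun h0 => h.ne_zero (le_antisymm ((h.le_of_ne_zero hj).trans (by rw [h0, map_zero])) zero_le)

theorem zpow_mul_pow (h : IsCyclotomicVal v q e) (r : ℤ) (d i : ℕ) :
    q ^ r * (q ^ d) ^ i = q ^ (r + d * i : ℤ) := by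
  rw [zpow_add₀ h.q_ne_zero, zpow_mul, zpow_natCast, zpow_natCast]

theorem pow_pow_eq (q : K) (d i : ℕ) : (q ^ d) ^ i = q ^ (d * i : ℤ) := by
  rw [zpow_mul, zpow_natCast, zpow_natCast]

variable {d : ℕ} {r : ℤ}

theorem natCast_dvd_mul_iff (hde : Nat.Coprime d e) (j : ℕ) : (e : ℤ) ∣ d * j ↔ e ∣ j := by
  rw [← Nat.cast_mul, Int.natCast_dvd_natCast]
  exact (Nat.Coprime.symm hde).dvd_mul_left

theorem one_sub_pow_ne_zero (h : IsCyclotomicVal v q e) (hd : 0 < d) {j : ℕ} (hj : 0 < j) :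
    1 - (q ^ d) ^ j ≠ 0 := by
  rw [pow_pow_eq]
  exact h.one_sub_ne_zero (by positivity)

theorem one_sub_pow_eq_one (h : IsCyclotomicVal v q e) (hde : Nat.Coprime d e) {j : ℕ}
    (hj : ¬e ∣ j) : v (1 - (q ^ d) ^ j) = 1 := by
  rw [pow_pow_eq]
  exact h.eq_one (mt (natCast_dvd_mul_iff hde j).1 hj)

theorem prod_block_le (h : IsCyclotomicVal v q e) (hde : Nat.Coprime d e) (r : ℤ) (k : ℕ) :
    v (∏ i ∈ Finset.range e, (1 - q ^ r * (q ^ d) ^ (k + i))) ≤ v (1 - q ^ (e : ℤ)) := by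
  obtain ⟨i, hi, hdvd⟩ := exists_lt_dvd_add_mul h.pos hde (r + d * k)
  rw [← Finset.mul_prod_erase _ _ (Finset.mem_range.2 hi), map_mul, map_prod, h.zpow_mul_pow]
  refine (mul_le_mul' (h.le_of_dvd ?_) (Finset.prod_le_one' fun j _ => ?_)).trans (mul_one _).le
  · rw [Nat.cast_add, mul_add, ← add_assoc]; exact hdvd
  · rw [h.zpow_mul_pow]; exact h.le_one _

theorem prod_block_eq (h : IsCyclotomicVal v q e) (hd : 0 < d) (hde : Nat.Coprime d e) (k : ℕ) :
    v (∏ i ∈ Finset.range e, (1 - q ^ d * (q ^ d) ^ (k + i))) = v (1 - q ^ (e : ℤ)) := by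
  obtain ⟨i, hi, hdvd⟩ := exists_lt_dvd_add_mul h.pos (Nat.coprime_one_left e) (k + 1)
  have hdvd' : e ∣ k + i + 1 := by
    have : (e : ℤ) ∣ ((k + i + 1 : ℕ) : ℤ) := by
      convert hdvd using 1; push_cast; ring
    exact_mod_cast this
  rw [map_prod, Finset.prod_eq_single_of_mem i (Finset.mem_range.2 hi)]
  · rw [← pow_succ', pow_pow_eq]
    exact h.eq_of_dvd _ (by positivity) ((natCast_dvd_mul_iff hde _).2 hdvd')
  · intro j hj hji
    rw [← pow_succ']
    refine h.one_sub_pow_eq_one hde fun hjd => hji ?_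
    rw [Finset.mem_range] at hj
    have h1 := (Nat.modEq_iff_dvd' (n := e) (a := 0) (Nat.zero_le (k + j + 1))).2 (by simpa using hjd)
    have h2 := (Nat.modEq_iff_dvd' (n := e) (a := 0) (Nat.zero_le (k + i + 1))).2 (by simpa using hdvd')
    have h3 : (k + 1) + j ≡ (k + 1) + i [MOD e] := by
      convert h1.symm.trans h2 using 1 <;> ring
    exact (Nat.ModEq.add_left_cancel' _ h3).eq_of_lt_of_lt hj hi

/-- Factors are removed `e` at a time. Among `e` consecutive numerator factors some exponent is
divisible by `e`; in the denominator exactly one is, with valuation exactly that of `1 - q^e`. With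
fewer than `e` factors the denominator is a unit. -/
theorem map_qPochRatio_le_one (h : IsCyclotomicVal v q e) (hd : 0 < d) (hde : Nat.Coprime d e)
    (r : ℤ) (k : ℕ) : v (qPochRatio (q ^ r) (q ^ d) k) ≤ 1 := by
  induction k using Nat.strong_induction_on with
  | _ k ih =>
    rcases lt_or_ge k e with hk | hk
    · rw [qPochRatio, map_div₀, map_prod, map_prod, Finset.prod_eq_one (s := Finset.range k)
        (f := fun i => v (1 - q ^ d * (q ^ d) ^ i)), div_one]
      · exact Finset.prod_le_one' fun j _ => by rw [h.zpow_mul_pow]; exact h.le_one _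
      · intro i hi
        rw [Finset.mem_range] at hi
        rw [← pow_succ']
        exact h.one_sub_pow_eq_one hde fun hdvd =>
          absurd (Nat.le_of_dvd i.succ_pos hdvd) (by omega)
    · obtain ⟨l, rfl⟩ := Nat.exists_eq_add_of_le' hk
      have hl := ih l (by have := h.pos; omega)
      rw [qPochRatio, Finset.prod_range_add, Finset.prod_range_add, mul_div_mul_comm, map_mul]
      refine mul_le_one' hl ?_
      rw [map_div₀, h.prod_block_eq hd hde]
      exact (div_le_one₀ (zero_lt_iff.2 h.ne_zero)).2 (h.prod_block_le hde r l)

theorem map_core_le_one (h : IsCyclotomicVal v q e) (hd : 0 < d) (hde : Nat.Coprime d e)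
    (r : ℤ) (k : ℕ) : v (wellPoisedCore (q ^ r) (q ^ d) k) ≤ 1 := by
  rw [wellPoisedCore]
  refine map_mul_le_one ?_ (map_pow_le_one (h.map_qPochRatio_le_one hd hde r k) 3)
  rw [map_mul, map_mul, map_pow, Valuation.map_neg, map_inv₀, map_pow, map_pow, map_pow,
    h.zpow_eq_one, h.base]
  simp

theorem core_rec (h : IsCyclotomicVal v q e) (hd : 0 < d) (r : ℤ) (k : ℕ) :
    WellPoisedRec (q ^ r) (q ^ d) (wellPoisedCore (q ^ r) (q ^ d)) k :=
  wellPoisedRec_core (zpow_ne_zero _ h.q_ne_zero) (h.one_sub_pow_ne_zero hd k.succ_pos)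

theorem sum_wellPoisedTerm_eq_core (h : IsCyclotomicVal v q e) (t : Finset ℕ) :
    ∑ k ∈ t, wellPoisedTerm (q ^ r) (q ^ d) k = ∑ k ∈ t, wellPoisedCore (q ^ r) (q ^ d) k *
      (((q ^ d) ^ k)⁻¹ * (1 - q ^ r * (q ^ d) ^ (2 * k))) :=
  Finset.sum_congr rfl fun k _ => wellPoisedTerm_eq_core (pow_ne_zero _ h.q_ne_zero) k

theorem map_sum_wellPoisedTerm_lt_one (h : IsCyclotomicVal v q e) (hd : 0 < d)
    (hde : Nat.Coprime d e) {l : ℕ} (hl : l < e) (hr : (e : ℤ) ∣ r + d * l) (c M : ℕ)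
    (hM : M = c * e + l ∨ M = c * e + (e - 1)) :
    v (∑ k ∈ Finset.range (M + 1), wellPoisedTerm (q ^ r) (q ^ d) k) < 1 := by
  rw [h.sum_wellPoisedTerm_eq_core]
  refine map_sum_wellPoisedRec_blocks_lt_one h.two (h.zpow_eq_one r).le
    (by rw [map_pow, h.base, one_pow]) hl (fun j => ?_) ?_ (h.map_core_le_one hd hde r)
    (h.core_rec hd r) c M hM
  · rw [pow_pow_eq, h.lt_one_iff, natCast_dvd_mul_iff hde]
  · rw [h.zpow_mul_pow, h.lt_one_iff]; exact hr

theorem _root_.WellPoisedRec.map_succ {A Q : K} {s : ℕ → K} {k : ℕ} (hA : v A = 1) (hQ : v Q = 1)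
    (hk : v (1 - Q ^ (k + 1)) = 1) (h : WellPoisedRec A Q s k) :
    v (s (k + 1)) = v (1 - A * Q ^ k) ^ 3 * v (s k) := by
  have h' := congrArg v h
  rwa [map_mul, map_mul, map_pow, hk, hA, Valuation.map_neg, map_mul, map_mul, map_pow, map_pow, hQ,
    one_pow, one_pow, one_mul, mul_one, one_mul] at h'

/-- The terms between `m + 1` and `e - 1` sum to a multiple of `(1 - x) ^ 3` by an element of
the maximal ideal, where `x = q ^ (r + d * m)`. -/
theorem exists_sum_tail (h : IsCyclotomicVal v q e) (hd : 0 < d) (hde : Nat.Coprime d e) {m : ℕ}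
    (hm : m < e) (hr : (e : ℤ) ∣ r + d * m) :
    ∃ y, v y < 1 ∧ ∑ k ∈ Finset.Ico (m + 1) e, wellPoisedTerm (q ^ r) (q ^ d) k =
      (1 - q ^ (r + d * m : ℤ)) ^ 3 * y := by
  obtain ⟨x, hx⟩ : ∃ x, x = 1 - q ^ (r + d * m : ℤ) := ⟨_, rfl⟩
  rw [← hx, h.sum_wellPoisedTerm_eq_core]
  have hrec := h.core_rec hd r
  have hA := h.zpow_eq_one r
  have hQ : v (q ^ d) = 1 := by rw [map_pow, h.base, one_pow]
  have hunit : ∀ k, k + 1 < e → v (1 - (q ^ d) ^ (k + 1)) = 1 := fun k hk =>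
    h.one_sub_pow_eq_one hde fun hdvd => absurd (Nat.le_of_dvd k.succ_pos hdvd) (by omega)
  have hbound : ∀ j, m + 1 + j < e → v (wellPoisedCore (q ^ r) (q ^ d) (m + 1 + j)) ≤ v x ^ 3 := by
    intro j
    induction j with
    | zero =>
      intro hj
      rw [add_zero, (hrec m).map_succ hA hQ (hunit m hj), h.zpow_mul_pow, ← hx]
      exact (mul_le_mul' le_rfl (h.map_core_le_one hd hde r m)).trans (mul_one _).le
    | succ j ih =>
      intro hj
      rw [← add_assoc, (hrec _).map_succ hA hQ (hunit _ (by omega)), h.zpow_mul_pow]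
      exact (mul_le_mul' (pow_le_one' (h.le_one _) 3) (ih (by omega))).trans (one_mul _).le
  -- When `r + dm = 0` division by `x^3` is impossible, but `hbound` then makes every tail term
  -- zero.
  rcases eq_or_ne x 0 with hx0 | hx0
  · refine ⟨0, by simp, ?_⟩
    rw [mul_zero]
    refine Finset.sum_eq_zero fun k hk => ?_
    rw [Finset.mem_Ico] at hk
    obtain ⟨j, rfl⟩ := Nat.exists_eq_add_of_le hk.1
    have hj := hbound j hk.2
    rw [hx0, map_zero, zero_pow three_ne_zero, nonpos_iff_eq_zero, map_eq_zero] at hj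
    rw [hj, zero_mul]
  · have hx3 : x ^ 3 ≠ 0 := pow_ne_zero 3 hx0
    rcases lt_or_ge (m + 1) e with hme | hme
    -- Division by `x^3` keeps the entries integral by `hbound` and preserves the recurrence, which
    -- is linear in `s`. The reflection is `k ↦ m + e - k`.
    · refine ⟨∑ k ∈ Finset.Ico (m + 1) (e - 1 + 1), (wellPoisedCore (q ^ r) (q ^ d) k / x ^ 3) *
        (((q ^ d) ^ k)⁻¹ * (1 - q ^ r * (q ^ d) ^ (2 * k))),
        map_sum_wellPoisedRec_lt_one (s := fun k => wellPoisedCore (q ^ r) (q ^ d) k / x ^ 3)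
          h.two hA.le hQ ?_ ?_ ?_ ?_, ?_⟩
      · rw [h.zpow_mul_pow, h.lt_one_iff]
        have h1 : m + 1 + (e - 1) = m + e := by omega
        rw [h1, Nat.cast_add, mul_add, ← add_assoc]
        exact dvd_add hr (dvd_mul_left _ _)
      · intro k hk hk'
        obtain ⟨j, rfl⟩ := Nat.exists_eq_add_of_le hk
        rw [map_div₀, map_pow]
        exact (div_le_one₀ (pow_pos (zero_lt_iff.2 ((map_ne_zero v).2 hx0)) 3)).2
          (hbound j (by omega))
      · intro k _ _
        have h1 := hrec k
        rw [WellPoisedRec] at h1 ⊢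
        linear_combination h1 / x ^ 3
      · intro k _ hk
        exact hunit k (by omega)
      · rw [Nat.sub_add_cancel h.pos, Finset.mul_sum]
        refine Finset.sum_congr rfl fun k _ => ?_
        rw [← mul_assoc (x ^ 3), mul_div_cancel₀ _ hx3]
    · exact ⟨0, by simp, by rw [Finset.Ico_eq_empty (by omega)]; simp⟩

end IsCyclotomicVal

end Valuation

/-! ### The `Φ_e`-adic valuations of `ℚ(q)` and divisibility of numerators. -/

section Cyclotomic

open IsDedekindDomain WithZero

/-- The prime of `ℚ[q]` generated by the `e`-th cyclotomic polynomial. -/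
def cyclotomicPrime (e : ℕ) (he : 0 < e) : HeightOneSpectrum ℚ[X] where
  asIdeal := Ideal.span {cyclotomic e ℚ}
  isPrime := (Ideal.span_singleton_prime (cyclotomic_ne_zero e ℚ)).2
    (cyclotomic.irreducible_rat he).prime
  ne_bot := by
    rw [Ne, Ideal.span_singleton_eq_bot]
    exact cyclotomic_ne_zero e ℚ

/-- The `Φ_e(q)`-adic valuation of `ℚ(q)`. -/
def cyclotomicVal (e : ℕ) (he : 0 < e) : Valuation (RatFunc ℚ) ℤᵐ⁰ :=
  (cyclotomicPrime e he).valuation (RatFunc ℚ)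

variable {e : ℕ} (he : 0 < e)

theorem cyclotomicVal_poly_le_one (p : ℚ[X]) :
    cyclotomicVal e he (algebraMap ℚ[X] (RatFunc ℚ) p) ≤ 1 :=
  HeightOneSpectrum.valuation_le_one _ p

theorem cyclotomicVal_poly_lt_one_iff (p : ℚ[X]) :
    cyclotomicVal e he (algebraMap ℚ[X] (RatFunc ℚ) p) < 1 ↔ cyclotomic e ℚ ∣ p := by
  rw [cyclotomicVal, HeightOneSpectrum.valuation_lt_one_iff_mem, cyclotomicPrime,
    Ideal.mem_span_singleton]

theorem cyclotomicVal_poly_eq_one {p : ℚ[X]} (h : ¬cyclotomic e ℚ ∣ p) :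
    cyclotomicVal e he (algebraMap ℚ[X] (RatFunc ℚ) p) = 1 :=
  le_antisymm (cyclotomicVal_poly_le_one he p)
    (not_lt.1 (mt (cyclotomicVal_poly_lt_one_iff he p).1 h))

theorem cyclotomic_pow_dvd_num {f : RatFunc ℚ} {k : ℕ}
    (h : cyclotomicVal e he f ≤ exp (-(k : ℤ))) : cyclotomic e ℚ ^ k ∣ f.num := by
  have h1 : cyclotomicVal e he (algebraMap ℚ[X] (RatFunc ℚ) f.num) ≤ exp (-(k : ℤ)) := by
    have h2 : algebraMap ℚ[X] (RatFunc ℚ) f.num = f * algebraMap ℚ[X] (RatFunc ℚ) f.denom := by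
      have h3 : algebraMap ℚ[X] (RatFunc ℚ) f.denom ≠ 0 :=
        RatFunc.algebraMap_ne_zero f.denom_ne_zero
      rw [← div_eq_iff h3, RatFunc.num_div_denom]
    rw [h2, map_mul]
    exact (mul_le_mul' h (cyclotomicVal_poly_le_one he _)).trans (mul_one _).le
  rwa [cyclotomicVal, HeightOneSpectrum.valuation_of_algebraMap,
    HeightOneSpectrum.intValuation_le_pow_iff_mem, cyclotomicPrime, Ideal.span_singleton_pow,
    Ideal.mem_span_singleton] at h1

theorem le_exp_neg_one_of_lt_one {a : ℤᵐ⁰} (h : a < 1) : a ≤ exp (-1) := by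
  rcases eq_or_ne a 0 with rfl | h0
  · simp
  · rw [← log_le_iff_le_exp h0]
    have := (log_lt_iff_lt_exp h0 (a := 0)).2 (by simpa using h)
    omega

theorem cyclotomic_dvd_iff_aeval {e : ℕ} (he : 0 < e) {ζ : ℂ} (hζ : IsPrimitiveRoot ζ e) (p : ℚ[X]) :
    cyclotomic e ℚ ∣ p ↔ aeval ζ p = 0 := by
  rw [cyclotomic_eq_minpoly_rat hζ he, minpoly.dvd_iff]

theorem cyclotomic_dvd_one_sub_X_pow_iff {e : ℕ} (he : 0 < e) (j : ℕ) :
    cyclotomic e ℚ ∣ 1 - X ^ j ↔ e ∣ j := by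
  have hζ := Complex.isPrimitiveRoot_exp e he.ne'
  rw [cyclotomic_dvd_iff_aeval he hζ, ← hζ.pow_eq_one_iff_dvd]
  rw [map_sub, map_one, map_pow, aeval_X, sub_eq_zero, eq_comm]

theorem cyclotomicVal_qvar : cyclotomicVal e he qvar = 1 := by
  have hζ := Complex.isPrimitiveRoot_exp e he.ne'
  rw [qvar, ← RatFunc.algebraMap_X]
  refine cyclotomicVal_poly_eq_one he ?_
  rw [cyclotomic_dvd_iff_aeval he hζ, aeval_X]
  exact hζ.ne_zero he.ne'

theorem algebraMap_one_sub_X_pow (j : ℕ) :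
    algebraMap ℚ[X] (RatFunc ℚ) (1 - X ^ j) = 1 - qvar ^ j := by
  simp

theorem cyclotomicVal_one_sub_zpow_neg (j : ℤ) :
    cyclotomicVal e he (1 - qvar ^ (-j)) = cyclotomicVal e he (1 - qvar ^ j) := by
  have hq : qvar ≠ 0 := RatFunc.X_ne_zero
  have h : 1 - qvar ^ (-j) = -(qvar ^ (-j) * (1 - qvar ^ j)) := by
    rw [mul_sub, ← zpow_add₀ hq, neg_add_cancel, zpow_zero]; ring
  rw [h, Valuation.map_neg, map_mul, map_zpow₀, cyclotomicVal_qvar, one_zpow, one_mul]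

theorem cyclotomicVal_one_sub_zpow_natAbs (j : ℤ) :
    cyclotomicVal e he (1 - qvar ^ j) = cyclotomicVal e he (1 - qvar ^ j.natAbs) := by
  rcases Int.natAbs_eq j with h | h
  · conv_lhs => rw [h]
    rw [zpow_natCast]
  · conv_lhs => rw [h]
    rw [cyclotomicVal_one_sub_zpow_neg, zpow_natCast]

/-- The quotient is a geometric sum in `q^e`, whose value at a primitive `e`-th root of unity is
`c`, nonzero in characteristic zero. -/
theorem cyclotomicVal_one_sub_pow_mul {c : ℕ} (hc : c ≠ 0) :
    cyclotomicVal e he (1 - qvar ^ (e * c)) = cyclotomicVal e he (1 - qvar ^ e) := by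
  have hζ := Complex.isPrimitiveRoot_exp e he.ne'
  have h := mul_neg_geom_sum (qvar ^ e) c
  have hs : ∑ i ∈ Finset.range c, (qvar ^ e) ^ i =
      algebraMap ℚ[X] (RatFunc ℚ) (∑ i ∈ Finset.range c, (X ^ e) ^ i) := by
    simp
  rw [pow_mul, ← h, map_mul, hs, cyclotomicVal_poly_eq_one, mul_one]
  rw [cyclotomic_dvd_iff_aeval he hζ]
  simpa [hζ.pow_eq_one] using hc

theorem isCyclotomicVal : IsCyclotomicVal (cyclotomicVal e he) qvar e where
  pos := he
  two := by
    have hζ := Complex.isPrimitiveRoot_exp e he.ne'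
    have h := cyclotomicVal_poly_eq_one he (p := 2) (by
      rw [cyclotomic_dvd_iff_aeval he hζ, map_ofNat]
      exact two_ne_zero)
    rwa [map_ofNat] at h
  base := cyclotomicVal_qvar he
  lt_one_iff j := by
    rw [cyclotomicVal_one_sub_zpow_natAbs, ← algebraMap_one_sub_X_pow,
      cyclotomicVal_poly_lt_one_iff, cyclotomic_dvd_one_sub_X_pow_iff he, Int.natCast_dvd]
  eq_of_dvd j hj hd := by
    obtain ⟨c, hc⟩ := Int.natCast_dvd.1 hd
    rw [cyclotomicVal_one_sub_zpow_natAbs, hc, cyclotomicVal_one_sub_pow_mul, zpow_natCast]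
    rintro rfl
    exact hj (Int.natAbs_eq_zero.1 (by simpa using hc))
  ne_zero := by
    rw [zpow_natCast, ← algebraMap_one_sub_X_pow, _root_.map_ne_zero]
    refine RatFunc.algebraMap_ne_zero fun h => ?_
    have h' := congrArg (eval 0) h
    simp [he.ne'] at h'

theorem qNatPoly_mul_cyclotomic_pow_dvd {n : ℕ} (hn : 1 < n) {p : ℚ[X]}
    (hn' : cyclotomic n ℚ ^ 4 ∣ p)
    (h : ∀ e, e ∣ n → 1 < e → e < n → cyclotomic e ℚ ∣ p) :
    qNatPoly n * cyclotomic n ℚ ^ 3 ∣ p := by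
  have hmem : n ∈ n.divisors.erase 1 := by simp; omega
  rw [qNatPoly, ← prod_cyclotomic_eq_geom_sum (by omega) ℚ, ← Finset.prod_erase_mul _ _ hmem,
    mul_assoc, ← pow_succ']
  refine IsCoprime.mul_dvd (IsCoprime.prod_left fun e he => IsCoprime.pow_right ?_) ?_ hn'
  · exact cyclotomic.isCoprime_rat (Finset.ne_of_mem_erase he)
  · refine Finset.prod_dvd_of_coprime
      (fun a _ b _ hab => cyclotomic.isCoprime_rat hab) fun e he => ?_
    simp only [Finset.mem_erase, Nat.mem_divisors] at he
    have h0 : 0 < e := Nat.pos_of_dvd_of_pos he.2.2.1 (by omega)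
    have h1 : e ≤ n := Nat.le_of_dvd (by omega) he.2.2.1
    exact h e he.2.2.1 (by omega) (by omega)

end Cyclotomic

/-! ### Comparison of the two sides of the congruence. -/

section Main

variable {K Γ : Type*} [Field K] [LinearOrderedCommGroupWithZero Γ]

/-- The finite sum in the cubic coefficient of the expansion of the well-poised series. -/
def cubicCoeff (Q : K) (m : ℕ) : K :=
  ∑ k ∈ Finset.Icc 1 m, (-1) ^ k * Q ^ (k + 1).choose 2 * (1 + Q ^ k) / (1 - Q ^ k) ^ 2

/-- The value, up to fourth order at `x = 1`, of the truncated well-poised series. -/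
def expansionValue (Q x : K) (m : ℕ) : K :=
  (-1) ^ m * (Q ^ (m + 1).choose 2)⁻¹ * x ^ m * ((1 - x) + (1 - x) ^ 3 * cubicCoeff Q m)

namespace IsCyclotomicVal

variable {v : Valuation K Γ} {q : K} {e d m : ℕ} {r : ℤ}

/-- Here `m` may exceed `e`, so `cubicCoeff` can have double poles at `Φ_e`. Each `1 - Q^k` vanishes
to at most the order of `1 - q^e`, hence of `1 - x`; thus `(1-x)^2` clears the poles and one factor
`1 - x` remains. -/
theorem map_expansionValue_lt_one (h : IsCyclotomicVal v q e) (hd : 0 < d)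
    (hr : (e : ℤ) ∣ r + d * m) :
    v (expansionValue (q ^ d) (q ^ (r + d * m : ℤ)) m) < 1 := by
  have hx1 := (h.lt_one_iff _).2 hr
  have hxle := h.le_of_dvd hr
  have hx := h.zpow_eq_one (r + d * m : ℤ)
  generalize q ^ (r + d * m : ℤ) = x at *
  have hQ : v (q ^ d) = 1 := by rw [map_pow, h.base, one_pow]
  have hH : v ((1 - x) ^ 2 * cubicCoeff (q ^ d) m) ≤ 1 := by
    rw [cubicCoeff, Finset.mul_sum]
    refine v.map_sum_le fun k hk => ?_
    have hk : 0 < k := (Finset.mem_Icc.1 hk).1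
    have hk' : v (1 - q ^ (e : ℤ)) ≤ v (1 - (q ^ d) ^ k) := by
      rw [pow_pow_eq]
      exact h.le_of_ne_zero (by positivity)
    have h1 : v ((-1) ^ k * (q ^ d) ^ (k + 1).choose 2 * (1 + (q ^ d) ^ k)) ≤ 1 := by
      refine map_mul_le_one ?_ ((v.map_add _ _).trans (max_le (map_one v).le
        (map_pow_le_one hQ.le k)))
      rw [map_mul, map_pow, map_pow, Valuation.map_neg, map_one, hQ, one_pow, one_pow, one_mul]
    have h2 : v ((1 - x) ^ 2 / (1 - (q ^ d) ^ k) ^ 2) ≤ 1 := by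
      rw [← div_pow, map_pow, map_div₀]
      exact pow_le_one' ((div_le_one₀ (zero_lt_iff.2 ((map_ne_zero v).2
        (h.one_sub_pow_ne_zero hd hk)))).2 (hxle.trans hk')) 2
    rw [mul_div_assoc', mul_comm ((1 - x) ^ 2), mul_div_assoc]
    exact map_mul_le_one h1 h2
  have hfac : expansionValue (q ^ d) x m = (1 - x) * ((-1) ^ m * ((q ^ d) ^ (m + 1).choose 2)⁻¹ *
      x ^ m * (1 + (1 - x) ^ 2 * cubicCoeff (q ^ d) m)) := by
    rw [expansionValue]; ring
  rw [hfac, map_mul]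
  refine (mul_le_mul' le_rfl (map_mul_le_one ?_ ((v.map_add _ _).trans
    (max_le (map_one v).le hH)))).trans_lt ((mul_one _).trans_lt hx1)
  rw [map_mul, map_mul, map_inv₀, map_pow v x, map_pow v (q ^ d), hx, hQ, map_pow,
    Valuation.map_neg]
  simp

/-- The truncated sum agrees with its expansion up to a multiple of `(1 - x) ^ 3` by an element of
the maximal ideal. -/
theorem exists_sum_sub_expansionValue (h : IsCyclotomicVal v q e) (hd : 0 < d)
    (hde : Nat.Coprime d e) (hm : m < e) (hr : (e : ℤ) ∣ r + d * m) {M : ℕ}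
    (hM : M = m ∨ M = e - 1) :
    ∃ y, v y < 1 ∧ ∑ k ∈ Finset.range (M + 1), wellPoisedTerm (q ^ r) (q ^ d) k -
      expansionValue (q ^ d) (q ^ (r + d * m : ℤ)) m = (1 - q ^ (r + d * m : ℤ)) ^ 3 * y := by
  have hQ : v (q ^ d) = 1 := by rw [map_pow, h.base, one_pow]
  have hx := h.zpow_eq_one (r + d * m : ℤ)
  have hA : q ^ (r + d * m : ℤ) * ((q ^ d) ^ m)⁻¹ = q ^ r := by
    rw [← h.zpow_mul_pow, mul_inv_cancel_right₀]
    exact pow_ne_zero _ (pow_ne_zero _ h.q_ne_zero)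
  have hmem : ∀ y : K, v y = 1 → y⁻¹ ∈ v.valuationSubring.toSubring := fun y hy => by
    rw [ValuationSubring.mem_toSubring, Valuation.mem_valuationSubring_iff, map_inv₀, hy, inv_one]
  obtain ⟨u, hu, hsum⟩ := sum_wellPoisedTerm_expansion (V := v.valuationSubring.toSubring)
    (pow_ne_zero d h.q_ne_zero) hQ.le (hmem _ hQ) (zpow_ne_zero _ h.q_ne_zero) hx.le
    (hmem _ hx) m (fun j hj _ => h.one_sub_pow_ne_zero hd hj)
    (fun j hj hjm => hmem _ (h.one_sub_pow_eq_one hde fun hdvd =>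
      absurd (Nat.le_of_dvd hj hdvd) (by omega)))
  rw [hA] at hsum
  have hu : v u ≤ 1 := hu
  have hlt : v ((1 - q ^ (r + d * m : ℤ)) * u) < 1 := by
    rw [map_mul]
    exact (mul_le_mul' le_rfl hu).trans_lt ((mul_one _).trans_lt ((h.lt_one_iff _).2 hr))
  obtain ⟨y, hy, htail⟩ := h.exists_sum_tail hd hde hm hr
  rcases hM with rfl | rfl
  · refine ⟨_, hlt, ?_⟩
    rw [hsum, expansionValue, cubicCoeff]
    ring
  · refine ⟨(1 - q ^ (r + d * m : ℤ)) * u + y, (v.map_add _ _).trans_lt (max_lt hlt hy), ?_⟩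
    rw [Nat.sub_add_cancel h.pos, ← Finset.sum_range_add_sum_Ico _ (Nat.succ_le_of_lt hm), htail,
      Nat.succ_eq_add_one, hsum, expansionValue, cubicCoeff]
    ring

end IsCyclotomicVal

theorem qvar_ne_zero : qvar ≠ 0 := RatFunc.X_ne_zero

theorem summand_eq (d : ℕ) (r : ℤ) (k : ℕ) :
    (-1) ^ k * qvar ^ ((d : ℤ) * ((k + 1).choose 2 : ℤ) - (k : ℤ) * r)
      * qInt (2 * (d : ℤ) * (k : ℤ) + r)
      * (qPoch (qvar ^ r) (qvar ^ d) k ^ 3 / qPoch (qvar ^ d) (qvar ^ d) k ^ 3) =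
    wellPoisedTerm (qvar ^ r) (qvar ^ d) k / (1 - qvar) := by
  have h1 : qvar ^ ((d : ℤ) * ((k + 1).choose 2 : ℤ) - (k : ℤ) * r) =
      (qvar ^ d) ^ (k + 1).choose 2 * ((qvar ^ r) ^ k)⁻¹ := by
    rw [zpow_sub₀ qvar_ne_zero, zpow_mul, mul_comm (k : ℤ), zpow_mul, zpow_natCast, zpow_natCast,
      zpow_natCast, div_eq_mul_inv]
  have h2 : qvar ^ (2 * (d : ℤ) * (k : ℤ) + r) = qvar ^ r * (qvar ^ d) ^ (2 * k) := by
    rw [add_comm, zpow_add₀ qvar_ne_zero, ← pow_mul, ← zpow_natCast qvar (d * (2 * k))]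
    push_cast
    ring_nf
  rw [h1, qInt, h2, wellPoisedTerm, qPoch, qPoch, div_pow]
  ring

theorem one_sub_qvar_ne_zero : 1 - qvar ≠ 0 := by
  have h := (isCyclotomicVal one_pos).one_sub_ne_zero one_ne_zero
  rwa [zpow_one] at h

theorem rhs_eq (d : ℕ) (r : ℤ) (m : ℕ) :
    (-1) ^ m * qvar ^ ((d : ℤ) * (m.choose 2 : ℤ) + (m : ℤ) * r)
      * (qInt ((m : ℤ) * (d : ℤ) + r)
        + qInt ((m : ℤ) * (d : ℤ) + r) ^ 3
          * ∑ k ∈ Finset.Icc 1 m,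
              (-1) ^ k * qvar ^ (d * (k + 1).choose 2) * (1 + qvar ^ (d * k))
                / qInt ((k : ℤ) * (d : ℤ)) ^ 2) =
    expansionValue (qvar ^ d) (qvar ^ (r + d * m : ℤ)) m / (1 - qvar) := by
  have hq := one_sub_qvar_ne_zero
  have h1 : qvar ^ ((d : ℤ) * (m.choose 2 : ℤ) + (m : ℤ) * r) =
      ((qvar ^ d) ^ (m + 1).choose 2)⁻¹ * (qvar ^ (r + d * m : ℤ)) ^ m := by
    rw [← pow_mul, ← zpow_natCast qvar (d * _), ← zpow_neg, ← zpow_natCast _ m, ← zpow_mul,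
      ← zpow_add₀ qvar_ne_zero]
    congr 1
    have h2 : m.choose 2 + (m + 1).choose 2 = m * m := by
      induction m with
      | zero => rfl
      | succ m ih =>
        rw [choose_two_step]
        have h := Nat.choose_succ_succ' m 1
        rw [Nat.choose_one_right] at h
        linarith
    have h3 : (m.choose 2 : ℤ) + ((m + 1).choose 2 : ℤ) = m * m := by exact_mod_cast h2
    push_cast
    linear_combination (d : ℤ) * h3
  have h2 : ∑ k ∈ Finset.Icc 1 m,
      (-1) ^ k * qvar ^ (d * (k + 1).choose 2) * (1 + qvar ^ (d * k))
        / qInt ((k : ℤ) * (d : ℤ)) ^ 2 = (1 - qvar) ^ 2 * cubicCoeff (qvar ^ d) m := by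
    rw [cubicCoeff, Finset.mul_sum]
    refine Finset.sum_congr rfl fun k _ => ?_
    have h3 : qvar ^ ((k : ℤ) * (d : ℤ)) = (qvar ^ d) ^ k := by
      rw [mul_comm, zpow_mul, zpow_natCast, zpow_natCast]
    rw [qInt, h3, pow_mul, pow_mul, div_pow, div_div_eq_mul_div, mul_comm ((1 - qvar) ^ 2),
      div_mul_eq_mul_div]
  have h3 : (m : ℤ) * (d : ℤ) + r = r + d * m := by ring
  rw [h1, h2, h3, qInt, expansionValue]
  field_simp

end Main

end

theorem theorem1p1 (n d : ℕ) (hn : 0 < n) (hd : 0 < d) (hnd : Nat.Coprime n d)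
    (r : ℤ) (hrd : IsCoprime r (d : ℤ))
    -- `m` is the least nonnegative residue of `-r/d` modulo `n`
    (m : ℕ) (hmn : m < n) (hm : (d : ℤ) * (m : ℤ) ≡ -r [ZMOD (n : ℤ)])
    (M : ℕ) (hM : M = m ∨ M = n - 1) :
    RatFuncCong (qNatPoly n * Polynomial.cyclotomic n ℚ ^ 3)
      (∑ k ∈ Finset.range (M + 1),
        (-1) ^ k * qvar ^ ((d : ℤ) * ((k + 1).choose 2 : ℤ) - (k : ℤ) * r)
          * qInt (2 * (d : ℤ) * (k : ℤ) + r)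
          * (qPoch (qvar ^ r) (qvar ^ d) k ^ 3 / qPoch (qvar ^ d) (qvar ^ d) k ^ 3))
      ((-1) ^ m * qvar ^ ((d : ℤ) * (m.choose 2 : ℤ) + (m : ℤ) * r)
        * (qInt ((m : ℤ) * (d : ℤ) + r)
          + qInt ((m : ℤ) * (d : ℤ) + r) ^ 3
            * ∑ k ∈ Finset.Icc 1 m,
                (-1) ^ k * qvar ^ (d * (k + 1).choose 2) * (1 + qvar ^ (d * k))
                  / qInt ((k : ℤ) * (d : ℤ)) ^ 2)) := by
  rw [RatFuncCong, rhs_eq, Finset.sum_congr rfl fun k _ => summand_eq d r k, ← Finset.sum_div,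
    ← sub_div]
  have hdvd : (n : ℤ) ∣ r + d * m := by
    have h := hm.symm.dvd
    rwa [sub_neg_eq_add, add_comm] at h
  rcases Nat.lt_or_ge 1 n with hn1 | hn1
  · have hunit : ∀ e (he : 0 < e), e ≠ 1 → cyclotomicVal e he (1 - qvar) = 1 := fun e he he1 => by
      have h := (isCyclotomicVal he).eq_one (j := 1) (by
        rw [Int.natCast_dvd]; simpa using he1)
      rwa [zpow_one] at h
    refine qNatPoly_mul_cyclotomic_pow_dvd hn1 (cyclotomic_pow_dvd_num hn ?_)
      fun e hen he1 hlt => ?_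
    -- Three powers of `Φ_n` come from `(1-x)^3` and the fourth from `y`.
    · have h := isCyclotomicVal hn
      obtain ⟨y, hy, hsum⟩ := h.exists_sum_sub_expansionValue hd hnd.symm hmn hdvd hM
      have hx := le_exp_neg_one_of_lt_one ((h.lt_one_iff _).2 hdvd)
      rw [map_div₀, hunit n hn hn1.ne', div_one, hsum, map_mul, map_pow]
      refine (mul_le_mul' (pow_le_pow_left' hx 3) (le_exp_neg_one_of_lt_one hy)).trans_eq ?_
      rw [← pow_succ, ← WithZero.exp_nsmul]
      simp
    · have he : 0 < e := by omega
      have h := isCyclotomicVal he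
      have hden : Nat.Coprime d e := (hnd.coprime_dvd_left hen).symm
      have hdvd' : (e : ℤ) ∣ r + d * m := (Int.natCast_dvd_natCast.2 hen).trans hdvd
      -- Modulo `e` the residue of `-r/d` is `m % e`, the point where blocks of length `e` are cut.
      have hl : (e : ℤ) ∣ r + d * (m % e : ℕ) := by
        have h1 : r + d * m = r + d * (m % e : ℕ) + e * (d * (m / e : ℕ)) := by
          have h2 : (m : ℤ) = (m % e : ℕ) + e * (m / e : ℕ) := by
            exact_mod_cast (Nat.mod_add_div m e).symm
          linear_combination (d : ℤ) * h2
        rw [h1] at hdvd'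
        exact (dvd_add_left (dvd_mul_right _ _)).1 hdvd'
      have hM' : ∃ c, M = c * e + m % e ∨ M = c * e + (e - 1) := by
        rcases hM with rfl | rfl
        · exact ⟨M / e, Or.inl (Nat.div_add_mod' M e).symm⟩
        · obtain ⟨c, rfl⟩ := hen
          obtain ⟨b, rfl⟩ : ∃ b, c = b + 1 :=
            ⟨c - 1, (Nat.sub_add_cancel (Nat.pos_of_mul_pos_left hn)).symm⟩
          refine ⟨b, Or.inr ?_⟩
          rw [mul_add, mul_one, mul_comm, Nat.add_sub_assoc he]
      obtain ⟨c, hc⟩ := hM'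
      have hL := h.map_sum_wellPoisedTerm_lt_one hd hden (Nat.mod_lt m he) hl c M hc
      have hR := h.map_expansionValue_lt_one hd hdvd'
      have key : cyclotomicVal e he ((∑ k ∈ Finset.range (M + 1),
          wellPoisedTerm (qvar ^ r) (qvar ^ d) k -
            expansionValue (qvar ^ d) (qvar ^ (r + d * m : ℤ)) m) / (1 - qvar)) < 1 := by
        rw [map_div₀, hunit e he he1.ne', div_one]
        exact (Valuation.map_sub _ _ _).trans_lt (max_lt hL hR)
      have := cyclotomic_pow_dvd_num he (k := 1) (le_exp_neg_one_of_lt_one key)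
      rwa [pow_one] at this
  -- For `n = 1` the factor `1 - q` is not a unit at `Φ_1`, but only the term `k = 0` occurs and
  -- both sides equal `[r]`.
  · obtain rfl : n = 1 := by omega
    obtain rfl : m = 0 := by omega
    obtain rfl : M = 0 := by omega
    simp [wellPoisedTerm, expansionValue, cubicCoeff]
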